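/- Let $E$ and $F$ be Banach spaces over the same field $\mathbb K\in\{\mathbb R,\mathbb C\}$ and let $n\ge 1$ be an integer. Let $\mathcal P(^nE,F)$ be the Banach space of continuous $n$-homogeneous polynomials $P\colon E\to F$ (that is, $P$ is continuous and $P(x)=A(x,\dots,x)$ for some symmetric $n$-linear map $A\colon E^n\to F$) with the norm $\|P\|=\sup_{\|x\|\le 1}\|P(x)\|$, and let $\mathcal P_w(^nE,F)$ be its subspace of those $P$ that are weakly continuous on bounded sets, that is, whose restriction to each bounded subset of $E$ is continuous from the weak topology to the norm topology of $F$. A closed subspace $J$ of a Banach space $X$ is called HB-smooth in $X$ if every functional in $J^*$ has a unique norm-preserving extension to a functional in $X^*$. Suppose that there is a surjective bounded linear map $\rho\colon E\to F$. If $\mathcal P_w(^nE,F)$ is HB-smooth in $\mathcal P(^nE,F)$ for some integer $n\ge 1$, then $F$, regarded as a subspace of $F^{**}$ via the canonical embedding, is HB-smooth in $F^{**}$. -/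

import Mathlib

/-- `P : E → F` is an `n`-homogeneous polynomial: `P x = A (x, …, x)` for some symmetric
`n`-linear map `A`. -/
def IsHomogeneousPolynomial (𝕜 : Type*) [RCLike 𝕜] (n : ℕ) {E F : Type*}
    [NormedAddCommGroup E] [NormedSpace 𝕜 E] [NormedAddCommGroup F] [NormedSpace 𝕜 F]
    (P : E → F) : Prop :=
  ∃ A : MultilinearMap 𝕜 (fun _ : Fin n => E) F,
    (∀ (σ : Equiv.Perm (Fin n)) (v : Fin n → E), A (v ∘ σ) = A v) ∧
      ∀ x : E, P x = A (fun _ => x)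

/-- The continuous `n`-homogeneous polynomials from `E` to `F`, as a linear space of functions. -/
def contHomogPolySubmodule (𝕜 : Type*) [RCLike 𝕜] (n : ℕ) (E F : Type*)
    [NormedAddCommGroup E] [NormedSpace 𝕜 E] [NormedAddCommGroup F] [NormedSpace 𝕜 F] :
    Submodule 𝕜 (E → F) where
  carrier := {P | IsHomogeneousPolynomial 𝕜 n P ∧ Continuous P}
  add_mem' := by
    rintro P Q ⟨⟨A, hA, hPA⟩, hP⟩ ⟨⟨B, hB, hQB⟩, hQ⟩
    refine ⟨⟨A + B, fun σ v => ?_, fun x => ?_⟩, hP.add hQ⟩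
    · simp [hA, hB]
    · simp [hPA, hQB]
  zero_mem' := ⟨⟨0, fun _ _ => rfl, fun _ => rfl⟩, continuous_const⟩
  smul_mem' := by
    rintro c P ⟨⟨A, hA, hPA⟩, hP⟩
    refine ⟨⟨c • A, fun σ v => ?_, fun x => ?_⟩, hP.const_smul c⟩
    · simp [hA]
    · simp [hPA]

/-- The space `𝒫(ⁿE, F)` of continuous `n`-homogeneous polynomials. It is a separate type (not
just the submodule above) so that it carries only the topology of the supremum norm. -/
def ContHomogPoly (𝕜 : Type*) [RCLike 𝕜] (n : ℕ) (E F : Type*)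
    [NormedAddCommGroup E] [NormedSpace 𝕜 E] [NormedAddCommGroup F] [NormedSpace 𝕜 F] :
    Type _ :=
  ↥(contHomogPolySubmodule 𝕜 n E F)

namespace ContHomogPoly

variable {𝕜 : Type*} [RCLike 𝕜] {n : ℕ} {E F : Type*}
  [NormedAddCommGroup E] [NormedSpace 𝕜 E] [NormedAddCommGroup F] [NormedSpace 𝕜 F]

noncomputable instance : AddCommGroup (ContHomogPoly 𝕜 n E F) :=
  inferInstanceAs (AddCommGroup ↥(contHomogPolySubmodule 𝕜 n E F))

noncomputable instance : Module 𝕜 (ContHomogPoly 𝕜 n E F) :=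
  inferInstanceAs (Module 𝕜 ↥(contHomogPolySubmodule 𝕜 n E F))

instance : CoeFun (ContHomogPoly 𝕜 n E F) (fun _ => E → F) :=
  ⟨fun P => P.1⟩

theorem ext {P Q : ContHomogPoly 𝕜 n E F} (h : ∀ x, P x = Q x) : P = Q :=
  Subtype.ext (funext h)

theorem add_apply (P Q : ContHomogPoly 𝕜 n E F) (x : E) : (P + Q) x = P x + Q x := rfl

theorem sub_apply (P Q : ContHomogPoly 𝕜 n E F) (x : E) : (P - Q) x = P x - Q x := rfl

theorem zero_apply (x : E) : (0 : ContHomogPoly 𝕜 n E F) x = 0 := rfl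

theorem smul_apply (c : 𝕜) (P : ContHomogPoly 𝕜 n E F) (x : E) : (c • P) x = c • P x := rfl

theorem continuous (P : ContHomogPoly 𝕜 n E F) : Continuous (P : E → F) := P.2.2

theorem map_smul (P : ContHomogPoly 𝕜 n E F) (c : 𝕜) (x : E) : P (c • x) = c ^ n • P x := by
  obtain ⟨A, -, hA⟩ := P.2.1
  have h := A.map_smul_univ (fun _ => c) (fun _ => x)
  simp only [Finset.prod_const, Finset.card_univ, Fintype.card_fin] at h
  rw [hA, hA, h]

/-- The supremum norm `‖P‖ = sup {‖P x‖ : ‖x‖ ≤ 1}`. -/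
noncomputable instance : Norm (ContHomogPoly 𝕜 n E F) :=
  ⟨fun P => sSup ((fun x : E => ‖P x‖) '' Metric.closedBall 0 1)⟩

theorem norm_def (P : ContHomogPoly 𝕜 n E F) :
    ‖P‖ = sSup ((fun x : E => ‖P x‖) '' Metric.closedBall 0 1) := rfl

theorem bddAbove (P : ContHomogPoly 𝕜 n E F) :
    BddAbove ((fun x : E => ‖P x‖) '' Metric.closedBall 0 1) := by
  obtain ⟨δ, hδ, h⟩ := Metric.continuous_iff.1 P.continuous 0 1 one_pos
  set c : 𝕜 := ((δ / 2 : ℝ) : 𝕜) with hc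
  have hcn : ‖c‖ = δ / 2 := by rw [hc, RCLike.norm_ofReal, abs_of_pos (by positivity)]
  have hc0 : 0 < ‖c‖ ^ n := by rw [hcn]; positivity
  refine ⟨(1 + ‖P 0‖) / ‖c‖ ^ n, ?_⟩
  rintro _ ⟨x, hx, rfl⟩
  rw [mem_closedBall_zero_iff] at hx
  have h1 : dist (c • x) 0 < δ := by
    rw [dist_zero_right, norm_smul, hcn]
    nlinarith [norm_nonneg x]
  have h2 := h _ h1
  rw [dist_eq_norm, P.map_smul] at h2
  have h3 : ‖c ^ n • P x‖ ≤ 1 + ‖P 0‖ := by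
    linarith [norm_le_norm_sub_add (c ^ n • P x) (P 0)]
  rw [norm_smul, norm_pow] at h3
  simp only
  rw [le_div_iff₀ hc0]
  linarith

theorem norm_apply_le_norm (P : ContHomogPoly 𝕜 n E F) {x : E} (hx : ‖x‖ ≤ 1) :
    ‖P x‖ ≤ ‖P‖ :=
  le_csSup P.bddAbove ⟨x, mem_closedBall_zero_iff.2 hx, rfl⟩

theorem norm_le_of_forall (P : ContHomogPoly 𝕜 n E F) {M : ℝ}
    (h : ∀ x, ‖x‖ ≤ 1 → ‖P x‖ ≤ M) : ‖P‖ ≤ M := by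
  refine csSup_le ⟨_, 0, by simp, rfl⟩ ?_
  rintro _ ⟨x, hx, rfl⟩
  exact h x (mem_closedBall_zero_iff.1 hx)

theorem norm_poly_nonneg (P : ContHomogPoly 𝕜 n E F) : 0 ≤ ‖P‖ :=
  (norm_nonneg (P 0)).trans (P.norm_apply_le_norm (by simp))

theorem norm_apply_le (P : ContHomogPoly 𝕜 n E F) (x : E) : ‖P x‖ ≤ ‖P‖ * ‖x‖ ^ n := by
  by_cases hx : x = 0
  · subst hx
    obtain rfl | hn := Nat.eq_zero_or_pos n
    · simpa using P.norm_apply_le_norm (x := 0) (by simp)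
    · have h := P.map_smul 0 0
      rw [zero_pow hn.ne', zero_smul, zero_smul] at h
      rw [h]
      simp [hn.ne']
  · have hx0 : ‖x‖ ≠ 0 := norm_ne_zero_iff.2 hx
    have h1 : ‖((‖x‖⁻¹ : ℝ) : 𝕜) • x‖ ≤ 1 := by
      rw [norm_smul, RCLike.norm_ofReal, abs_of_nonneg (by positivity), inv_mul_cancel₀ hx0]
    have h2 := P.norm_apply_le_norm h1
    rw [P.map_smul, norm_smul, norm_pow, RCLike.norm_ofReal, abs_of_nonneg (by positivity),
      inv_pow, inv_mul_le_iff₀ (by positivity)] at h2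
    linarith

theorem normCore : NormedSpace.Core 𝕜 (ContHomogPoly 𝕜 n E F) where
  norm_nonneg P := P.norm_poly_nonneg
  norm_smul c P := by
    apply le_antisymm
    · refine norm_le_of_forall _ fun x hx => ?_
      rw [smul_apply, norm_smul]
      exact mul_le_mul_of_nonneg_left (P.norm_apply_le_norm hx) (norm_nonneg c)
    · by_cases hc : c = 0
      · subst hc
        simpa using norm_poly_nonneg _
      · have hc' : 0 < ‖c‖ := norm_pos_iff.2 hc
        rw [← le_div_iff₀' hc']
        refine norm_le_of_forall _ fun x hx => ?_
        rw [le_div_iff₀' hc', ← norm_smul, ← smul_apply]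
        exact norm_apply_le_norm _ hx
  norm_triangle P Q := by
    refine norm_le_of_forall _ fun x hx => ?_
    rw [add_apply]
    exact (norm_add_le _ _).trans
      (add_le_add (P.norm_apply_le_norm hx) (Q.norm_apply_le_norm hx))
  norm_eq_zero_iff P := by
    constructor
    · intro h
      refine ext fun x => ?_
      have h1 := P.norm_apply_le x
      rw [h, zero_mul] at h1
      rw [zero_apply]
      exact norm_le_zero_iff.1 h1
    · rintro rfl
      refine le_antisymm (norm_le_of_forall _ fun x _ => ?_) (norm_poly_nonneg _)
      rw [zero_apply, norm_zero]

noncomputable instance : NormedAddCommGroup (ContHomogPoly 𝕜 n E F) :=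
  NormedAddCommGroup.ofCore (normCore (𝕜 := 𝕜) (n := n) (E := E) (F := F))

noncomputable instance : NormedSpace 𝕜 (ContHomogPoly 𝕜 n E F) :=
  NormedSpace.ofCore (normCore (𝕜 := 𝕜) (n := n) (E := E) (F := F))

end ContHomogPoly

/-- The subspace `𝒫_w(ⁿE, F)` of the polynomials that are weakly continuous on bounded sets:
the restriction of `P` to every bounded set is continuous from the weak topology of `E` to the
norm topology of `F`, that is, `P` maps bounded weakly convergent nets to convergent nets. -/
def weaklyContHomogPoly (𝕜 : Type*) [RCLike 𝕜] (n : ℕ) (E F : Type*)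
    [NormedAddCommGroup E] [NormedSpace 𝕜 E] [NormedAddCommGroup F] [NormedSpace 𝕜 F] :
    Submodule 𝕜 (ContHomogPoly 𝕜 n E F) where
  carrier := {P | ∀ s : Set E, Bornology.IsBounded s →
    ContinuousOn (fun x : WeakSpace 𝕜 E => P ((toWeakSpace 𝕜 E).symm x))
      (toWeakSpace 𝕜 E '' s)}
  add_mem' hP hQ s hs := (hP s hs).add (hQ s hs)
  zero_mem' _ _ := continuousOn_const
  smul_mem' c _ hP s hs := (hP s hs).const_smul c

theorem isClosed_weaklyContHomogPoly (𝕜 : Type*) [RCLike 𝕜] (n : ℕ) (E F : Type*)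
    [NormedAddCommGroup E] [NormedSpace 𝕜 E] [NormedAddCommGroup F] [NormedSpace 𝕜 F] :
    IsClosed (weaklyContHomogPoly 𝕜 n E F : Set (ContHomogPoly 𝕜 n E F)) := by
  rw [← isSeqClosed_iff_isClosed]
  intro u P hu hP s hs
  obtain ⟨R, hR0, hR⟩ := hs.exists_pos_norm_le
  have hlim : TendstoUniformlyOn
      (fun (k : ℕ) (x : WeakSpace 𝕜 E) => u k ((toWeakSpace 𝕜 E).symm x))
      (fun x => P ((toWeakSpace 𝕜 E).symm x)) Filter.atTop (toWeakSpace 𝕜 E '' s) := by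
    rw [Metric.tendstoUniformlyOn_iff]
    intro ε hε
    have h1 := (tendsto_iff_norm_sub_tendsto_zero.1 hP).mul_const (R ^ n)
    rw [zero_mul] at h1
    filter_upwards [h1.eventually_lt_const hε] with k hk
    rintro _ ⟨x, hx, rfl⟩
    rw [LinearEquiv.symm_apply_apply, dist_comm, dist_eq_norm]
    calc ‖u k x - P x‖ = ‖(u k - P) x‖ := rfl
      _ ≤ ‖u k - P‖ * ‖x‖ ^ n := (u k - P).norm_apply_le x
      _ ≤ ‖u k - P‖ * R ^ n := by
        have := hR x hx
        gcongr
      _ < ε := hk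
  exact hlim.continuousOn (Filter.Frequently.of_forall fun k => hu k s hs)

/-- A subspace `J` of `X` is HB-smooth in `X` if it is closed and every continuous linear
functional on `J` has a unique norm-preserving extension to a continuous linear functional
on `X`. -/
def IsHBSmooth {𝕜 : Type*} [RCLike 𝕜] {X : Type*} [NormedAddCommGroup X] [NormedSpace 𝕜 X]
    (J : Submodule 𝕜 X) : Prop :=
  IsClosed (J : Set X) ∧
    ∀ g : StrongDual 𝕜 J, ∃! f : StrongDual 𝕜 X, (∀ y : J, f y = g y) ∧ ‖f‖ = ‖g‖

/-! Let `f₁`, `f₂` be norm-preserving extensions to `F**` of the same functional `g` on `F`, and let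
`w` be in `F**`. As `ρ` is onto, `w` is the image under `ρ**` of some `z` in `E**`, and Goldstine
gives an ultrafilter on the ball of radius `‖z‖` tending weak-star to `z`. Weak-star limits along it
define a linear map `B` from polynomials to `F**` with `‖B‖ ≤ ‖z‖ ^ n`.

Weakly continuous polynomials send this filter to a Cauchy filter, so `B` maps them into `F`, and
`f₁ ∘ B`, `f₂ ∘ B` agree on them. Testing on `φ ^ n • y` shows that their common restriction already
has norm `‖g‖ * ‖z‖ ^ n`. Both compositions are therefore norm-preserving extensions, and
HB-smoothness makes them equal. Since `B` sends `φ ^ (n - 1) • ρ` to `z φ ^ (n - 1) • w`, choosing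
`z φ ≠ 0` gives `f₁ w = f₂ w`. -/

open Filter Topology

section

set_option maxSynthPendingDepth 3

/-! ### Weak-star approximation in the bidual. -/

/-- **Goldstine's theorem**, filter form. -/
theorem exists_ultrafilter_tendsto_bidual {𝕜 E : Type*} [RCLike 𝕜] [NormedAddCommGroup E]
    [NormedSpace 𝕜 E] (z : StrongDual 𝕜 (StrongDual 𝕜 E)) :
    ∃ U : Ultrafilter E, (∀ᶠ x in (U : Filter E), ‖x‖ ≤ ‖z‖) ∧
      ∀ φ : StrongDual 𝕜 E, Tendsto φ U (𝓝 (z φ)) := by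
  classical
  have hz0 : 0 ≤ ‖z‖ := norm_nonneg z
  have key : ∀ s : Finset (StrongDual 𝕜 E), (fun φ : s => z φ) ∈
      closure ((fun x : E => fun φ : s => (φ : StrongDual 𝕜 E) x) '' Metric.closedBall 0 ‖z‖) := by
    intro s
    by_contra hz
    let T : E →ₗ[𝕜] (s → 𝕜) := LinearMap.pi fun φ : s => (φ : StrongDual 𝕜 E).toLinearMap
    have hconv : Convex ℝ (closure ((fun x : E => fun φ : s => (φ : StrongDual 𝕜 E) x) ''
        Metric.closedBall 0 ‖z‖)) := by
      let _ : NormedSpace ℝ E := NormedSpace.restrictScalars ℝ 𝕜 E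
      exact ((convex_closedBall (0 : E) ‖z‖).linear_image (T.restrictScalars ℝ)).closure
    obtain ⟨f, u, hf, hu⟩ := RCLike.geometric_hahn_banach_closed_point (𝕜 := 𝕜) hconv
      isClosed_closure hz
    -- In finitely many coordinates the separating functional is evaluation at a single `ψ` in `E*`.
    set ψ : StrongDual 𝕜 E := ∑ φ : s, f (Pi.single φ 1) • (φ : StrongDual 𝕜 E) with hψ
    have hrep : ∀ v : s → 𝕜, f v = ∑ φ : s, f (Pi.single φ 1) * v φ := by
      intro v
      have := LinearMap.pi_apply_eq_sum_univ f.toLinearMap v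
      simp only [ContinuousLinearMap.coe_coe, smul_eq_mul] at this
      rw [this]
      refine Finset.sum_congr rfl fun φ _ => ?_
      rw [mul_comm]
      congr 2
      ext j
      simp [Pi.single_apply, eq_comm]
    have hfx : ∀ x : E, f (fun φ : s => (φ : StrongDual 𝕜 E) x) = ψ x := by
      intro x
      rw [hrep, hψ]
      simp
    have hfz : f (fun φ : s => z φ) = z ψ := by
      rw [hrep, hψ]
      simp
    have hball : ∀ x : E, ‖x‖ ≤ ‖z‖ → RCLike.re (ψ x) ≤ u := fun x hx => by
      rw [← hfx]
      exact (hf _ (subset_closure ⟨x, mem_closedBall_zero_iff.2 hx, rfl⟩)).le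
    have hnorm : ∀ x : E, ‖x‖ ≤ ‖z‖ → ‖ψ x‖ ≤ u := by
      intro x hx
      -- Rotating `x` by a unimodular scalar turns the bound on the real part into one on the norm.
      obtain ⟨c, hc, hcx⟩ := RCLike.exists_norm_eq_mul_self (ψ x)
      have h1 := hball (c • x) (by rwa [norm_smul, hc, one_mul])
      rw [map_smul, smul_eq_mul, ← hcx, RCLike.ofReal_re] at h1
      exact h1
    have h2 : ‖z‖ * ‖ψ‖ ≤ u := by
      have hu0 : 0 ≤ u := (norm_nonneg _).trans (hnorm 0 (by rwa [norm_zero]))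
      have h3 : ‖((‖z‖ : ℝ) : 𝕜) • ψ‖ ≤ u := by
        refine ContinuousLinearMap.opNorm_le_of_unit_norm hu0 fun x hx => ?_
        rw [smul_apply, ← map_smul]
        refine hnorm _ ?_
        rw [norm_smul, hx, mul_one, RCLike.norm_ofReal, abs_of_nonneg hz0]
      rwa [norm_smul, RCLike.norm_ofReal, abs_of_nonneg hz0] at h3
    rw [hfz] at hu
    have h4 := (RCLike.re_le_norm (z ψ)).trans (z.le_opNorm ψ)
    linarith
  let J : E → StrongDual 𝕜 E → 𝕜 := fun x φ => φ x
  have hne : (comap J (𝓝 fun φ => z φ) ⊓ 𝓟 (Metric.closedBall 0 ‖z‖)).NeBot := by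
    rw [inf_principal_neBot_iff]
    intro t ht
    obtain ⟨W, hW, hWt⟩ := mem_comap.1 ht
    rw [nhds_pi, mem_pi'] at hW
    obtain ⟨s, V, hV, hVW⟩ := hW
    obtain ⟨_, hy, x, hx, rfl⟩ := mem_closure_iff_nhds.1 (key s)
      (Set.pi Set.univ fun φ : s => V φ) (set_pi_mem_nhds Set.finite_univ fun φ _ => hV φ)
    exact ⟨x, hWt (hVW fun φ hφ => hy ⟨φ, hφ⟩ trivial), hx⟩
  refine ⟨@Ultrafilter.of _ _ hne, ?_, fun φ => ?_⟩
  · filter_upwards [Ultrafilter.of_le _ (mem_inf_of_right (mem_principal_self _))] with x hx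
    exact mem_closedBall_zero_iff.1 hx
  · have h1 : Tendsto J (@Ultrafilter.of _ _ hne) (𝓝 fun φ => z φ) :=
      tendsto_comap.mono_left ((Ultrafilter.of_le _).trans inf_le_left)
    exact tendsto_pi_nhds.1 h1 φ

/-! ### Iterated differences of multilinear maps. -/

/-- Functions all of whose iterated differences of length `m` vanish. -/
def DifferenceDegreeLT {E F : Type*} [AddCommGroup E] [AddCommGroup F] : ℕ → (E → F) → Prop
  | 0, g => ∀ x, g x = 0
  | m + 1, g => ∀ y, DifferenceDegreeLT m fun x => g (x + y) - g x

namespace DifferenceDegreeLT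

variable {E F : Type*} [AddCommGroup E] [AddCommGroup F]

theorem zero (m : ℕ) : DifferenceDegreeLT m (fun _ : E => (0 : F)) := by
  induction m with
  | zero => exact fun _ => rfl
  | succ m ih => intro y; simpa using ih

theorem add {m : ℕ} {g h : E → F} (hg : DifferenceDegreeLT m g) (hh : DifferenceDegreeLT m h) :
    DifferenceDegreeLT m fun x => g x + h x := by
  induction m generalizing g h with
  | zero => intro x; simp [hg x, hh x]
  | succ m ih =>
    intro y
    simpa only [add_sub_add_comm] using ih (hg y) (hh y)

theorem sum {ι : Type*} {m : ℕ} {g : ι → E → F} (s : Finset ι)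
    (hg : ∀ i ∈ s, DifferenceDegreeLT m (g i)) : DifferenceDegreeLT m fun x => ∑ i ∈ s, g i x := by
  classical
  induction s using Finset.induction_on with
  | empty => simpa using zero m
  | insert i s hi ih =>
    simp only [Finset.sum_insert hi]
    exact (hg i (by simp)).add (ih fun j hj => hg j (by simp [hj]))

theorem succ {m : ℕ} {g : E → F} (hg : DifferenceDegreeLT m g) : DifferenceDegreeLT (m + 1) g := by
  induction m generalizing g with
  | zero => intro y x; simp [hg x, hg (x + y)]
  | succ m ih => exact fun y => ih (hg y)

theorem mono {m k : ℕ} (hmk : m ≤ k) {g : E → F} (hg : DifferenceDegreeLT m g) :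
    DifferenceDegreeLT k g := by
  induction hmk with
  | refl => exact hg
  | step _ ih => exact ih.succ

end DifferenceDegreeLT

/-- Expanding at `x + y` gives one term for each subset of the slots in `s`. The difference cancels
the full subset, so every remaining term has `x` in strictly fewer slots. -/
theorem MultilinearMap.differenceDegreeLT_piecewise {𝕜 ι E F : Type*} [DecidableEq ι] [Ring 𝕜]
    [AddCommGroup E] [Module 𝕜 E] [AddCommGroup F] [Module 𝕜 F]
    (A : MultilinearMap 𝕜 (fun _ : ι => E) F) (s : Finset ι) (v : ι → E) :
    DifferenceDegreeLT (s.card + 1) fun x => A (s.piecewise (fun _ => x) v) := by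
  induction s using Finset.strongInduction generalizing v with
  | H s ih =>
    intro y
    have hexp : ∀ x, A (s.piecewise (fun _ => x + y) v) - A (s.piecewise (fun _ => x) v) =
        ∑ t ∈ s.ssubsets, A (t.piecewise (fun _ => x) (s.piecewise (fun _ => y) v)) := by
      intro x
      have h1 := A.map_piecewise_add (fun _ => x) (s.piecewise (fun _ => y) v) s
      have h2 : s.piecewise ((fun _ => x) + s.piecewise (fun _ => y) v)
          (s.piecewise (fun _ => y) v) = s.piecewise (fun _ => x + y) v := by
        ext i
        by_cases hi : i ∈ s <;> simp [hi]
      have h3 : s.piecewise (fun _ => x) (s.piecewise (fun _ => y) v) =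
          s.piecewise (fun _ => x) v := by
        ext i
        by_cases hi : i ∈ s <;> simp [hi]
      rw [h2] at h1
      rw [h1, Finset.ssubsets, ← Finset.sum_erase_add _ _ (Finset.mem_powerset_self s), h3,
        add_sub_cancel_right]
    simp only [hexp]
    refine DifferenceDegreeLT.sum _ fun t ht => ?_
    rw [Finset.mem_ssubsets] at ht
    exact (ih t ht _).mono (Finset.card_lt_card ht)

/-! ### Weakly Cauchy filters. -/

theorem tendsto_toWeakSpace {𝕜 E α : Type*} [RCLike 𝕜] [NormedAddCommGroup E] [NormedSpace 𝕜 E]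
    {l : Filter α} {f : α → E} {x : E}
    (h : ∀ φ : StrongDual 𝕜 E, Tendsto (fun i => φ (f i)) l (𝓝 (φ x))) :
    Tendsto (fun i => toWeakSpace 𝕜 E (f i)) l (𝓝 (toWeakSpace 𝕜 E x)) := by
  have hinj : Function.Injective (topDualPairing 𝕜 E).flip := fun x y hxy =>
    (SeparatingDual.eq_iff_forall_dual_eq (R := 𝕜)).2 fun φ => LinearMap.congr_fun hxy φ
  exact (WeakBilin.tendsto_iff_forall_eval_tendsto _ hinj).2 h

/-- A function that is weakly continuous on bounded sets and has finite difference degree maps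
weakly Cauchy bounded filters to Cauchy filters. -/
theorem DifferenceDegreeLT.exists_mem_norm_sub_lt {𝕜 E F : Type*} [RCLike 𝕜]
    [NormedAddCommGroup E] [NormedSpace 𝕜 E] [NormedAddCommGroup F] {m : ℕ} {g : E → F}
    (hg : DifferenceDegreeLT m g)
    (hw : ∀ s : Set E, Bornology.IsBounded s →
      ContinuousOn (fun x : WeakSpace 𝕜 E => g ((toWeakSpace 𝕜 E).symm x)) (toWeakSpace 𝕜 E '' s))
    {l : Filter E} [l.NeBot] {r : ℝ} (hr : ∀ᶠ x in l, ‖x‖ ≤ r)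
    (hl : ∀ φ : StrongDual 𝕜 E, ∃ a, Tendsto φ l (𝓝 a)) {ε : ℝ} (hε : 0 < ε) :
    ∃ S ∈ l, ∀ x ∈ S, ∀ y ∈ S, ‖g x - g y‖ < ε := by
  induction m generalizing g ε with
  | zero => exact ⟨Set.univ, univ_mem, fun x _ y _ => by rwa [hg x, hg y, sub_zero, norm_zero]⟩
  | succ m ih =>
    -- The filter need not converge weakly in `E`, but differences of its points tend weakly to `0`,
    -- where weak continuity applies.
    have h0 : Tendsto (fun p : E × E => g (p.1 - p.2)) (l ×ˢ l) (𝓝 (g 0)) := by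
      have hc := hw (Metric.closedBall 0 (2 * r)) Metric.isBounded_closedBall
        (toWeakSpace 𝕜 E 0) ⟨0, by
          obtain ⟨x, hx⟩ := hr.exists
          have := (norm_nonneg x).trans hx
          simpa using this, rfl⟩
      have ht : Tendsto (fun p : E × E => toWeakSpace 𝕜 E (p.1 - p.2)) (l ×ˢ l)
          (𝓝[toWeakSpace 𝕜 E '' Metric.closedBall 0 (2 * r)] (toWeakSpace 𝕜 E 0)) := by
        refine tendsto_nhdsWithin_iff.2 ⟨?_, ?_⟩
        · refine tendsto_toWeakSpace fun φ => ?_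
          obtain ⟨a, ha⟩ := hl φ
          have := (ha.comp tendsto_fst).sub (ha.comp (tendsto_snd (f := l) (g := l)))
          simpa [Function.comp_def] using this
        · filter_upwards [hr.prod_mk hr] with p hp
          refine ⟨_, ?_, rfl⟩
          rw [mem_closedBall_zero_iff]
          linarith [norm_sub_le p.1 p.2, hp.1, hp.2]
      have := hc.tendsto.comp ht
      simpa [Function.comp_def] using this
    obtain ⟨S, hS, hSg⟩ : ∃ S ∈ l, ∀ x ∈ S, ∀ y ∈ S, ‖g (x - y) - g 0‖ < ε / 3 := by
      have := h0.eventually (Metric.ball_mem_nhds (g 0) (by positivity : 0 < ε / 3))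
      obtain ⟨S, hS, h⟩ := mem_prod_same_iff.1 this
      exact ⟨S, hS, fun x hx y hy => by
        simpa [dist_eq_norm] using h (Set.mk_mem_prod hx hy)⟩
    -- With `y` fixed, `g (x - y)` is nearly constant, and `g (x - y) - g x` has lower difference
    -- degree, so induction controls it.
    obtain ⟨y, hy⟩ := nonempty_of_mem hS
    have hwd : ∀ s : Set E, Bornology.IsBounded s → ContinuousOn (fun x : WeakSpace 𝕜 E =>
        (fun x => g (x + -y) - g x) ((toWeakSpace 𝕜 E).symm x)) (toWeakSpace 𝕜 E '' s) := by
      intro s hs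
      have hs' : Bornology.IsBounded ((fun x => x + -y) '' s) :=
        ((LipschitzWith.id.add (LipschitzWith.const (-y))).isBounded_image hs)
      have hshift : Continuous fun x : WeakSpace 𝕜 E => x + toWeakSpace 𝕜 E (-y) :=
        continuous_id.add continuous_const
      refine ContinuousOn.sub (((hw _ hs').comp hshift.continuousOn ?_).congr ?_) (hw s hs)
      · rintro _ ⟨x, hx, rfl⟩
        exact ⟨x + -y, ⟨x, hx, rfl⟩, map_add _ _ _⟩
      · rintro _ ⟨x, hx, rfl⟩
        simp
    obtain ⟨S', hS', hd⟩ := ih (hg (-y)) hwd (by positivity : 0 < ε / 3)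
    refine ⟨S ∩ S', inter_mem hS hS', fun x hx x' hx' => ?_⟩
    have e1 := hSg x hx.1 y hy
    have e2 := hSg x' hx'.1 y hy
    have e3 := hd x hx.2 x' hx'.2
    have : g x - g x' = (g (x - y) - g 0) - (g (x' - y) - g 0) -
        ((g (x + -y) - g x) - (g (x' + -y) - g x')) := by
      rw [sub_eq_add_neg x, sub_eq_add_neg x']; abel
    rw [this]
    linarith [norm_sub_le ((g (x - y) - g 0) - (g (x' - y) - g 0))
      ((g (x + -y) - g x) - (g (x' + -y) - g x')),
      norm_sub_le (g (x - y) - g 0) (g (x' - y) - g 0)]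


/-! ### Test polynomials and limits of weakly continuous polynomials. -/

/-- Averaging over all permutations of the slots makes `A` symmetric without changing its diagonal.
-/
theorem MultilinearMap.isHomogeneousPolynomial_diagonal {𝕜 E F : Type*} [RCLike 𝕜]
    [NormedAddCommGroup E] [NormedSpace 𝕜 E] [NormedAddCommGroup F] [NormedSpace 𝕜 F] {n : ℕ}
    (A : MultilinearMap 𝕜 (fun _ : Fin n => E) F) :
    IsHomogeneousPolynomial 𝕜 n fun x => A fun _ => x := by
  refine ⟨((n.factorial : 𝕜)⁻¹) • ∑ τ : Equiv.Perm (Fin n), A.domDomCongr τ, fun σ v => ?_,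
    fun x => ?_⟩
  · simp only [smul_apply, sum_apply, MultilinearMap.domDomCongr_apply,
      Function.comp_apply]
    congr 1
    exact Fintype.sum_equiv (Equiv.mulLeft σ) _ _ fun τ => rfl
  · have hn : (n.factorial : 𝕜) ≠ 0 := Nat.cast_ne_zero.2 n.factorial_ne_zero
    simp [Fintype.card_perm, ← Nat.cast_smul_eq_nsmul 𝕜, smul_smul, hn]

section

variable {𝕜 E F : Type*} [RCLike 𝕜] [NormedAddCommGroup E] [NormedSpace 𝕜 E]
  [NormedAddCommGroup F] [NormedSpace 𝕜 F]

theorem isHomogeneousPolynomial_pow_smul (m : ℕ) (φ : StrongDual 𝕜 E) (T : E →L[𝕜] F) :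
    IsHomogeneousPolynomial 𝕜 (m + 1) fun x => φ x ^ m • T x := by
  let A : MultilinearMap 𝕜 (fun _ : Fin (m + 1) => E) F := LinearMap.uncurryLeft
    { toFun := fun x => ((MultilinearMap.mkPiAlgebra 𝕜 (Fin m) 𝕜).compLinearMap
        fun _ => φ.toLinearMap).smulRight (T x)
      map_add' := fun x y => by ext; simp
      map_smul' := fun c x => by ext; simp [smul_comm c] }
  have hA : (fun x => φ x ^ m • T x) = fun x => A fun _ => x := by
    ext x
    simp [A, Fin.tail]
  rw [hA]
  exact A.isHomogeneousPolynomial_diagonal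

/-- The polynomial `x ↦ φ(x)ᵐ T(x)` of degree `m + 1`. -/
def ContHomogPoly.powSMul (m : ℕ) (φ : StrongDual 𝕜 E) (T : E →L[𝕜] F) :
    ContHomogPoly 𝕜 (m + 1) E F :=
  ⟨fun x => φ x ^ m • T x, isHomogeneousPolynomial_pow_smul m φ T, by fun_prop⟩

theorem ContHomogPoly.powSMul_apply (m : ℕ) (φ : StrongDual 𝕜 E) (T : E →L[𝕜] F) (x : E) :
    powSMul m φ T x = φ x ^ m • T x := rfl

theorem ContHomogPoly.powSMul_smulRight_mem (m : ℕ) (φ : StrongDual 𝕜 E) (y : F) :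
    powSMul m φ (φ.smulRight y) ∈ weaklyContHomogPoly 𝕜 (m + 1) E F := by
  intro s _
  have hφ : Continuous fun x : WeakSpace 𝕜 E => φ ((toWeakSpace 𝕜 E).symm x) :=
    WeakBilin.eval_continuous (topDualPairing 𝕜 E).flip φ
  exact ((hφ.pow m).smul (hφ.smul continuous_const)).continuousOn

theorem ContHomogPoly.norm_powSMul_smulRight_le (m : ℕ) {φ : StrongDual 𝕜 E} (hφ : ‖φ‖ ≤ 1)
    (y : F) : ‖powSMul m φ (φ.smulRight y)‖ ≤ ‖y‖ := by
  refine norm_le_of_forall _ fun x hx => ?_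
  have h1 : ‖φ x‖ ≤ 1 := (φ.le_opNorm x).trans (mul_le_one₀ hφ (norm_nonneg x) hx)
  rw [powSMul_apply, ContinuousLinearMap.smulRight_apply, smul_smul, ← pow_succ, norm_smul,
    norm_pow]
  exact mul_le_of_le_one_left (norm_nonneg y) (pow_le_one₀ (norm_nonneg _) h1)

theorem ContHomogPoly.differenceDegreeLT {n : ℕ} (P : ContHomogPoly 𝕜 n E F) :
    DifferenceDegreeLT (n + 1) (P : E → F) := by
  obtain ⟨A, -, hA⟩ := P.2.1
  have h := A.differenceDegreeLT_piecewise Finset.univ 0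
  simp only [Finset.piecewise_univ, Finset.card_univ, Fintype.card_fin] at h
  rwa [show (P : E → F) = fun x => A fun _ => x from funext hA]

theorem exists_tendsto_of_mem_weaklyContHomogPoly [CompleteSpace F] {n : ℕ}
    {P : ContHomogPoly 𝕜 n E F} (hP : P ∈ weaklyContHomogPoly 𝕜 n E F) {l : Filter E} [l.NeBot]
    {r : ℝ} (hr : ∀ᶠ x in l, ‖x‖ ≤ r) (hl : ∀ φ : StrongDual 𝕜 E, ∃ a, Tendsto φ l (𝓝 a)) :
    ∃ y, Tendsto (P : E → F) l (𝓝 y) := by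
  have hc : Cauchy (map (P : E → F) l) := by
    refine Metric.cauchy_iff.2 ⟨inferInstance, fun ε hε => ?_⟩
    obtain ⟨S, hS, h⟩ := P.differenceDegreeLT.exists_mem_norm_sub_lt hP hr hl hε
    refine ⟨P.1 '' S, image_mem_map hS, ?_⟩
    rintro _ ⟨x, hx, rfl⟩ _ ⟨y, hy, rfl⟩
    rw [dist_eq_norm]
    exact h x hx y hy
  exact CompleteSpace.complete hc

/-! ### Passing to the biduals. -/

/-- The extension of polynomials along a bounded ultrafilter, with values in the bidual. -/
theorem exists_ultrafilter_extension (n : ℕ) (U : Ultrafilter E) {r : ℝ} (hr0 : 0 ≤ r)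
    (hr : ∀ᶠ x in (U : Filter E), ‖x‖ ≤ r) :
    ∃ B : ContHomogPoly 𝕜 n E F →L[𝕜] StrongDual 𝕜 (StrongDual 𝕜 F),
      (∀ P ψ, Tendsto (fun x => ψ (P x)) U (𝓝 (B P ψ))) ∧ ‖B‖ ≤ r ^ n := by
  have hbound : ∀ (P : ContHomogPoly 𝕜 n E F) (ψ : StrongDual 𝕜 F),
      ∀ᶠ x in (U : Filter E), ‖ψ (P x)‖ ≤ r ^ n * ‖P‖ * ‖ψ‖ := by
    intro P ψ
    filter_upwards [hr] with x hx
    calc ‖ψ (P x)‖ ≤ ‖ψ‖ * ‖P x‖ := ψ.le_opNorm _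
      _ ≤ ‖ψ‖ * (‖P‖ * r ^ n) := by
        have := P.norm_poly_nonneg
        gcongr
        exact (P.norm_apply_le x).trans (by gcongr)
      _ = _ := by ring
  have hlim : ∀ (P : ContHomogPoly 𝕜 n E F) (ψ : StrongDual 𝕜 F),
      ∃ a : 𝕜, Tendsto (fun x => ψ (P x)) U (𝓝 a) := by
    intro P ψ
    obtain ⟨a, -, ha⟩ := (isCompact_closedBall (0 : 𝕜) (r ^ n * ‖P‖ * ‖ψ‖)).ultrafilter_le_nhds
      (U.map fun x => ψ (P x)) (le_principal_iff.2 (by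
        exact (hbound P ψ).mono fun x hx => mem_closedBall_zero_iff.2 hx))
    exact ⟨a, ha⟩
  choose b hb using hlim
  let B : ContHomogPoly 𝕜 n E F →ₗ[𝕜] StrongDual 𝕜 F →ₗ[𝕜] 𝕜 := LinearMap.mk₂ 𝕜 b
    (fun P Q ψ => tendsto_nhds_unique (hb _ _) (by
      simpa [ContHomogPoly.add_apply] using (hb P ψ).add (hb Q ψ)))
    (fun c P ψ => tendsto_nhds_unique (hb _ _) (by
      simpa [ContHomogPoly.smul_apply] using (hb P ψ).const_smul c))
    (fun P ψ χ => tendsto_nhds_unique (hb _ _) (by simpa using (hb P ψ).add (hb P χ)))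
    (fun c P ψ => tendsto_nhds_unique (hb _ _) (by simpa using (hb P ψ).const_smul c))
  exact ⟨B.mkContinuous₂ (r ^ n) fun P ψ => le_of_tendsto (hb P ψ).norm (hbound P ψ), hb,
    LinearMap.mkContinuous₂_norm_le _ (by positivity) _⟩

/-- By the open mapping theorem the adjoint of `ρ` is bounded below, so `w` induces a bounded
functional on its range, which Hahn-Banach extends. -/
theorem exists_comp_eq_of_surjective [CompleteSpace E] [CompleteSpace F] (ρ : E →L[𝕜] F)
    (hρ : Function.Surjective ρ) (w : StrongDual 𝕜 (StrongDual 𝕜 F)) :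
    ∃ z : StrongDual 𝕜 (StrongDual 𝕜 E), ∀ ψ : StrongDual 𝕜 F, z (ψ.comp ρ) = w ψ := by
  obtain ⟨C, hC, hpre⟩ := ρ.exists_preimage_norm_le hρ
  let T : StrongDual 𝕜 F →ₗ[𝕜] StrongDual 𝕜 E :=
    { toFun := fun ψ => ψ.comp ρ
      map_add' := fun _ _ => rfl
      map_smul' := fun _ _ => rfl }
  have hT : ∀ ψ, ‖ψ‖ ≤ C * ‖T ψ‖ := by
    intro ψ
    refine ψ.opNorm_le_bound (by positivity) fun y => ?_
    obtain ⟨x, rfl, hx⟩ := hpre y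
    calc ‖ψ (ρ x)‖ = ‖T ψ x‖ := rfl
      _ ≤ ‖T ψ‖ * ‖x‖ := (T ψ).le_opNorm x
      _ ≤ ‖T ψ‖ * (C * ‖ρ x‖) := by gcongr
      _ = _ := by ring
  have hinj : Function.Injective T := by
    refine (injective_iff_map_eq_zero T).2 fun ψ hψ => ?_
    have := hT ψ
    rw [hψ, norm_zero, mul_zero] at this
    exact norm_le_zero_iff.1 this
  let e := LinearEquiv.ofInjective T hinj
  let z₀ : StrongDual 𝕜 (LinearMap.range T) :=
    (w.toLinearMap ∘ₗ e.symm.toLinearMap).mkContinuous (‖w‖ * C) fun v => by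
      obtain ⟨ψ, rfl⟩ := e.surjective v
      have h1 : ‖w ψ‖ ≤ ‖w‖ * (C * ‖T ψ‖) := (w.le_opNorm ψ).trans (by gcongr; exact hT ψ)
      simpa [e, mul_assoc] using h1
  obtain ⟨z, hz, -⟩ := exists_extension_norm_eq _ z₀
  refine ⟨z, fun ψ => ?_⟩
  have := hz (e ψ)
  have h2 : z₀ (e ψ) = w ψ := congrArg w (e.symm_apply_apply ψ)
  exact this.trans h2

variable [CompleteSpace F]

/-! ### Uniqueness of extensions. -/

/-- HB-smoothness applies because composing with `B` loses no norm: the upper bound `‖g‖ * ‖z‖ ^ (m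
+ 1)` is attained already on the weakly continuous polynomials. -/
theorem eq_on_ultrafilter_extension {m : ℕ}
    (h : IsHBSmooth (weaklyContHomogPoly 𝕜 (m + 1) E F))
    {z : StrongDual 𝕜 (StrongDual 𝕜 E)} {U : Ultrafilter E}
    (hU : ∀ᶠ x in (U : Filter E), ‖x‖ ≤ ‖z‖)
    (hz : ∀ φ : StrongDual 𝕜 E, Tendsto φ U (𝓝 (z φ)))
    {B : ContHomogPoly 𝕜 (m + 1) E F →L[𝕜] StrongDual 𝕜 (StrongDual 𝕜 F)}
    (hB : ∀ P ψ, Tendsto (fun x => ψ (P x)) U (𝓝 (B P ψ))) (hBn : ‖B‖ ≤ ‖z‖ ^ (m + 1))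
    {g : StrongDual 𝕜 (NormedSpace.inclusionInDoubleDual 𝕜 F).range}
    {f₁ f₂ : StrongDual 𝕜 (StrongDual 𝕜 (StrongDual 𝕜 F))}
    (h₁ : (∀ y : (NormedSpace.inclusionInDoubleDual 𝕜 F).range, f₁ y = g y) ∧ ‖f₁‖ = ‖g‖)
    (h₂ : (∀ y : (NormedSpace.inclusionInDoubleDual 𝕜 F).range, f₂ y = g y) ∧ ‖f₂‖ = ‖g‖)
    (P : ContHomogPoly 𝕜 (m + 1) E F) : f₁ (B P) = f₂ (B P) := by
  let W := weaklyContHomogPoly 𝕜 (m + 1) E F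
  let R := (NormedSpace.inclusionInDoubleDual 𝕜 F).range
  have hBW : ∀ P ∈ W, B P ∈ R := by
    intro P hP
    obtain ⟨y, hy⟩ := exists_tendsto_of_mem_weaklyContHomogPoly hP hU fun φ => ⟨_, hz φ⟩
    refine ⟨y, ?_⟩
    ext ψ
    exact tendsto_nhds_unique ((ψ.continuous.tendsto y).comp hy) (hB P ψ)
  let G : StrongDual 𝕜 W := (f₁.comp B).comp W.subtypeL
  have hG : ∀ f : StrongDual 𝕜 (StrongDual 𝕜 (StrongDual 𝕜 F)), (∀ y : R, f y = g y) →
      ∀ P : W, f (B P) = G P := fun f hf P => by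
    have e1 := hf ⟨B P, hBW P P.2⟩
    have e2 := h₁.1 ⟨B P, hBW P P.2⟩
    exact e1.trans e2.symm
  have hlower : ‖g‖ * ‖z‖ ^ (m + 1) ≤ ‖G‖ := by
    -- `‖z‖` need not be attained, so test with `‖φ‖ < 1` and `‖z φ‖ > r`, then let `r` increase to
    -- `‖z‖`.
    have hr : ∀ r ∈ Set.Ico 0 ‖z‖, ‖g‖ * r ^ (m + 1) ≤ ‖G‖ := by
      rintro r ⟨hr0, hrz⟩
      obtain ⟨φ, hφ, hrφ⟩ := z.exists_lt_apply_of_lt_opNorm hrz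
      obtain rfl | hr0 := hr0.eq_or_lt
      · simp
      rw [← le_div_iff₀ (by positivity)]
      refine g.opNorm_le_bound (by positivity) ?_
      rintro ⟨_, y, rfl⟩
      set Q := ContHomogPoly.powSMul m φ (φ.smulRight y)
      have hQ : Q ∈ W := ContHomogPoly.powSMul_smulRight_mem m φ y
      have hBQ : B Q = z φ ^ (m + 1) • NormedSpace.inclusionInDoubleDual 𝕜 F y := by
        ext ψ
        refine tendsto_nhds_unique (hB Q ψ) ?_
        have := ((hz φ).pow (m + 1)).mul_const (ψ y)
        simpa [Q, ContHomogPoly.powSMul_apply, pow_succ, mul_assoc] using this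
      have e1 : ‖G ⟨Q, hQ⟩‖ ≤ ‖G‖ * ‖y‖ := (G.le_opNorm _).trans (by
        gcongr
        exact ContHomogPoly.norm_powSMul_smulRight_le m hφ.le y)
      have e2 : G ⟨Q, hQ⟩ =
          z φ ^ (m + 1) * g ⟨NormedSpace.inclusionInDoubleDual 𝕜 F y, y, rfl⟩ := by
        change f₁ (B Q) = _
        rw [hBQ, map_smul, smul_eq_mul]
        exact congrArg _ (h₁.1 ⟨_, y, rfl⟩)
      rw [e2, norm_mul, norm_pow] at e1
      have e3 : ‖NormedSpace.inclusionInDoubleDual 𝕜 F y‖ = ‖y‖ :=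
        (NormedSpace.inclusionInDoubleDualLi 𝕜).norm_map y
      have e4 : r ^ (m + 1) ≤ ‖z φ‖ ^ (m + 1) := by gcongr
      change _ ≤ _ * ‖NormedSpace.inclusionInDoubleDual 𝕜 F y‖
      rw [e3, div_mul_eq_mul_div, le_div_iff₀ (by positivity), mul_comm]
      exact (mul_le_mul_of_nonneg_right e4 (norm_nonneg _)).trans e1
    obtain hz0 | hz0 := (norm_nonneg z).eq_or_lt
    · rw [← hz0]; simp
    · have hcont : Continuous fun r : ℝ => ‖g‖ * r ^ (m + 1) := by fun_prop
      refine le_of_tendsto (hcont.continuousWithinAt (s := Set.Iio ‖z‖)) ?_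
      filter_upwards [Ico_mem_nhdsLT hz0] with r hr' using hr r hr'
  have hext : ∀ f : StrongDual 𝕜 (StrongDual 𝕜 (StrongDual 𝕜 F)),
      (∀ y : R, f y = g y) ∧ ‖f‖ = ‖g‖ →
        (∀ P : W, f.comp B P = G P) ∧ ‖f.comp B‖ = ‖G‖ := by
    rintro f ⟨hf, hfn⟩
    refine ⟨hG f hf, le_antisymm ?_ ?_⟩
    · refine (f.opNorm_comp_le B).trans (le_trans ?_ hlower)
      rw [hfn]
      gcongr
    · refine G.opNorm_le_bound (norm_nonneg _) fun P => ?_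
      rw [← hG f hf P]
      exact (f.comp B).le_opNorm P
  exact DFunLike.congr_fun ((h.2 G).unique (hext f₁ h₁) (hext f₂ h₂)) P

theorem isClosed_range_inclusionInDoubleDual :
    IsClosed ((NormedSpace.inclusionInDoubleDual 𝕜 F).range :
      Set (StrongDual 𝕜 (StrongDual 𝕜 F))) :=
  (NormedSpace.inclusionInDoubleDualLi 𝕜 (E := F)).isometry.isClosedEmbedding.isClosed_range

end

theorem isHBSmooth_range_inclusionInDoubleDual {𝕜 : Type*} [RCLike 𝕜] {E F : Type*}
    [NormedAddCommGroup E] [NormedSpace 𝕜 E] [CompleteSpace E]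
    [NormedAddCommGroup F] [NormedSpace 𝕜 F] [CompleteSpace F]
    (ρ : E →L[𝕜] F) (hρ : Function.Surjective ρ)
    (n : ℕ) (hn : 1 ≤ n) (h : IsHBSmooth (weaklyContHomogPoly 𝕜 n E F)) :
    IsHBSmooth (𝕜 := 𝕜) (X := StrongDual 𝕜 (StrongDual 𝕜 F))
      (NormedSpace.inclusionInDoubleDual 𝕜 F).range := by
  obtain ⟨m, rfl⟩ := Nat.exists_eq_add_of_le' hn
  refine ⟨isClosed_range_inclusionInDoubleDual, fun g => ?_⟩
  refine existsUnique_of_exists_of_unique (exists_extension_norm_eq _ g) fun f₁ f₂ h₁ h₂ => ?_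
  ext w
  obtain ⟨z, hzw⟩ := exists_comp_eq_of_surjective ρ hρ w
  -- The factor `z φ ^ m` has to be cancelled at the end, so a `φ` with `z φ ≠ 0` is needed.
  by_cases hz0 : z = 0
  · have hw : w = 0 := by
      ext ψ
      simp [← hzw, hz0]
    rw [hw, map_zero, map_zero]
  obtain ⟨φ, hφ⟩ : ∃ φ, z φ ≠ 0 := by
    by_contra! hφ
    exact hz0 (ContinuousLinearMap.ext hφ)
  obtain ⟨U, hU, hz⟩ := exists_ultrafilter_tendsto_bidual z
  obtain ⟨B, hB, hBn⟩ :=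
    exists_ultrafilter_extension (𝕜 := 𝕜) (F := F) (m + 1) U (norm_nonneg z) hU
  have hBP : B (ContHomogPoly.powSMul m φ ρ) = z φ ^ m • w := by
    ext ψ
    refine tendsto_nhds_unique (hB _ ψ) ?_
    have := ((hz φ).pow m).mul (hz (ψ.comp ρ))
    simpa [ContHomogPoly.powSMul_apply, hzw] using this
  have key := eq_on_ultrafilter_extension h hU hz hB hBn h₁ h₂ (ContHomogPoly.powSMul m φ ρ)
  rw [hBP, map_smul, map_smul] at key
  exact smul_right_injective 𝕜 (pow_ne_zero m hφ) key

end

theorem proposition4p1 {𝕜 : Type*} [RCLike 𝕜] {E F : Type*}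
    [NormedAddCommGroup E] [NormedSpace 𝕜 E] [CompleteSpace E]
    [NormedAddCommGroup F] [NormedSpace 𝕜 F] [CompleteSpace F]
    (ρ : E →L[𝕜] F) (hρ : Function.Surjective ρ)
    (n : ℕ) (hn : 1 ≤ n) (h : IsHBSmooth (weaklyContHomogPoly 𝕜 n E F)) :
    IsHBSmooth (𝕜 := 𝕜) (X := StrongDual 𝕜 (StrongDual 𝕜 F))
      (NormedSpace.inclusionInDoubleDual 𝕜 F).range := by
  exact isHBSmooth_range_inclusionInDoubleDual ρ hρ n hn h
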